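/- Let $\operatorname{sinc}(x)=\frac{\sin x}{x}$ for $x\neq 0$ and $\operatorname{sinc}(0)=1$, and let $\|\mathbf s\|_\infty=\max_i|s_i|$. For every $n$ and every $\mathbf s=(s_1,\ldots,s_n)\in\mathbb R^n$ with $s_1^2+\cdots+s_n^2=1$, the improper integrals $\int_0^\infty(\cdot)\,dt=\lim_{T\to\infty}\int_0^T(\cdot)\,dt$ below converge and $$\|\mathbf s\|_\infty\int_0^\infty\prod_{i=1}^n\operatorname{sinc}(s_it)\,dt\;\ge\;\int_0^\infty\operatorname{sinc}(t)^n\,dt .$$ Equality holds only if $n=2$ or $\mathbf s/\|\mathbf s\|_\infty$ is a vertex of the cube $[-1,1]^n$. -/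

import Mathlib

/-- The integral of `f` over `[0, ∞)`, as an improper Riemann integral, converges and has
the value `I`: the integrals of `f` over `[0, T]` tend to `I` as `T → ∞`. -/
def HasImproperIntegral (f : ℝ → ℝ) (I : ℝ) : Prop :=
  Filter.Tendsto (fun T : ℝ => ∫ t in (0 : ℝ)..T, f t) Filter.atTop (nhds I)

/-- The cube `[-1, 1]ⁿ`. -/
def cube (n : ℕ) : Set (Fin n → ℝ) :=
  Set.Icc (fun _ => -1) (fun _ => 1)

/-- A vertex of the cube `[-1, 1]ⁿ`, that is, an extreme point. -/
def IsCubeVertex {n : ℕ} (v : Fin n → ℝ) : Prop :=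
  v ∈ Set.extremePoints ℝ (cube n)

/-- The maximum norm of a vector of Euclidean space; the norm on `Fin n → ℝ` is the maximum norm. -/
noncomputable def maxNorm {n : ℕ} (s : EuclideanSpace ℝ (Fin n)) : ℝ :=
  ‖(WithLp.ofLp s : Fin n → ℝ)‖

open MeasureTheory Set Filter Topology Real

/-! Rescale to `v i = |s i| / maxNorm s`, which lies in `[0, 1]` with some `v i = 1`; the claim is
that raising the other entries to `1` does not increase the integral. If `φ` is a product of sincs,
at least two with positive scale, its cosine transform is even and nonincreasing on the half line:
explicit for two factors, and preserved by each further factor `sinc (b * t)`, which averages the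
transform over `[x - b, x + b]` (`HasAntitoneCosTransform.mul_sinc`). Then `∫ φ t * sinc (b * t)` is
the mean of the transform over `[-b, b]`, nonincreasing in `b`. With only two scales the integral is
constant, hence the exception `n = 2`; for `n ≥ 3` the last change is strict
(`sincIntegral_one_lt`). -/

/-! ### Cosine transforms and multiplication by sinc -/

/-- The cosine transform of `φ` on the half line `(0, ∞)`. -/
noncomputable def cosTransform (φ : ℝ → ℝ) (x : ℝ) : ℝ :=
  ∫ t in Ioi (0 : ℝ), cos (x * t) * φ t

lemma cosTransform_neg (φ : ℝ → ℝ) (x : ℝ) : cosTransform φ (-x) = cosTransform φ x := by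
  simp [cosTransform]

lemma cosTransform_abs (φ : ℝ → ℝ) (x : ℝ) : cosTransform φ |x| = cosTransform φ x := by
  rcases abs_choice x with h | h <;> rw [h]
  exact cosTransform_neg φ x

lemma cosTransform_zero (φ : ℝ → ℝ) : cosTransform φ 0 = ∫ t in Ioi (0 : ℝ), φ t := by
  simp [cosTransform]

lemma continuous_cosTransform {φ : ℝ → ℝ} (hφ : IntegrableOn φ (Ioi 0)) :
    Continuous (cosTransform φ) := by
  refine continuous_of_dominated (bound := fun t => ‖φ t‖) (fun x => ?_) (fun x => ?_) hφ.norm ?_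
  · exact (by fun_prop : Continuous fun t => cos (x * t)).aestronglyMeasurable.mul
      hφ.aestronglyMeasurable
  · refine Eventually.of_forall fun t => ?_
    rw [norm_mul]
    exact mul_le_of_le_one_left (norm_nonneg _) (abs_cos_le_one _)
  · exact Eventually.of_forall fun t => by fun_prop

lemma integral_cos_add_mul (p q : ℝ) :
    ∫ u in (-1 : ℝ)..1, cos (p + q * u) = 2 * (cos p * sinc q) := by
  by_cases hq : q = 0
  · norm_num [hq]
  · rw [intervalIntegral.integral_comp_add_mul (fun y => cos y) hq, integral_cos, sinc_of_ne_zero hq,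
      smul_eq_mul, mul_one, mul_neg_one, sin_add, sin_add, sin_neg, cos_neg]
    field_simp
    ring

lemma MeasureTheory.IntegrableOn.mul_sinc {φ : ℝ → ℝ} {s : Set ℝ} (hφ : IntegrableOn φ s) (b : ℝ) :
    IntegrableOn (fun t => φ t * sinc (b * t)) s := by
  refine Integrable.mono hφ (hφ.aestronglyMeasurable.mul
    (by fun_prop : Continuous fun t => sinc (b * t)).aestronglyMeasurable) ?_
  refine Eventually.of_forall fun t => ?_
  rw [norm_mul]
  exact mul_le_of_le_one_right (norm_nonneg _) (abs_sinc_le_one _)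

lemma cosTransform_mul_sinc {φ : ℝ → ℝ} (hφ : IntegrableOn φ (Ioi 0)) (b x : ℝ) :
    2 * cosTransform (fun t => φ t * sinc (b * t)) x =
      ∫ u in (-1 : ℝ)..1, cosTransform φ (x + b * u) := by
  simp only [cosTransform]
  rw [intervalIntegral.integral_of_le (by norm_num), integral_integral_swap,
    ← integral_const_mul]
  · refine integral_congr_ae (Eventually.of_forall fun t => ?_)
    simp only
    rw [← intervalIntegral.integral_of_le (by norm_num), intervalIntegral.integral_mul_const]
    have := integral_cos_add_mul (x * t) (b * t)
    rw [show (fun u => cos ((x + b * u) * t)) = fun u => cos (x * t + b * t * u) by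
      funext u; ring_nf, this]
    ring
  · have h1 : Integrable (fun _ : ℝ => (1 : ℝ)) (volume.restrict (Ioc (-1 : ℝ) 1)) := by simp
    refine Integrable.mono (h1.mul_prod hφ) ?_ ?_
    · refine AEStronglyMeasurable.mul (f := fun p : ℝ × ℝ => cos ((x + b * p.1) * p.2))
        (g := fun p : ℝ × ℝ => φ p.2) ?_ ?_
      · exact (by fun_prop : Continuous fun p : ℝ × ℝ =>
          cos ((x + b * p.1) * p.2)).aestronglyMeasurable
      · exact hφ.aestronglyMeasurable.comp_snd
    · refine Eventually.of_forall fun p => ?_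
      simp only [Function.uncurry, norm_mul, norm_one]
      exact mul_le_mul_of_nonneg_right (abs_cos_le_one _) (norm_nonneg _)

lemma cosTransform_mul_sinc_zero {φ : ℝ → ℝ} (hφ : IntegrableOn φ (Ioi 0)) (b : ℝ) :
    2 * ∫ t in Ioi (0 : ℝ), φ t * sinc (b * t) =
      ∫ u in (-1 : ℝ)..1, cosTransform φ (b * u) := by
  simpa [cosTransform_zero] using cosTransform_mul_sinc hφ b 0

/-- In the difference of two window integrals of width `2 * b` only the moving endpoints contribute.
-/
lemma cosTransform_mul_sinc_sub {φ : ℝ → ℝ} (hφ : IntegrableOn φ (Ioi 0)) {b : ℝ} (hb : 0 < b)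
    (x y : ℝ) :
    2 * b * (cosTransform (fun t => φ t * sinc (b * t)) x -
        cosTransform (fun t => φ t * sinc (b * t)) y) =
      ∫ u in x..y, (cosTransform φ (u - b) - cosTransform φ (u + b)) := by
  have hc := continuous_cosTransform hφ
  have key (z : ℝ) : 2 * b * cosTransform (fun t => φ t * sinc (b * t)) z =
      ∫ u in (z - b)..(z + b), cosTransform φ u := by
    have h := cosTransform_mul_sinc hφ b z
    rw [intervalIntegral.integral_comp_add_mul _ hb.ne', smul_eq_mul, mul_one, mul_neg_one,
      ← sub_eq_add_neg] at h
    rw [mul_right_comm, h]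
    field_simp
  rw [mul_sub, key, key, intervalIntegral.integral_interval_sub_interval_comm
    (hc.intervalIntegrable _ _) (hc.intervalIntegrable _ _) (hc.intervalIntegrable _ _),
    intervalIntegral.integral_sub, intervalIntegral.integral_comp_sub_right,
    intervalIntegral.integral_comp_add_right]
  · exact (hc.comp (by fun_prop : Continuous fun u : ℝ => u - b)).intervalIntegrable _ _
  · exact (hc.comp (by fun_prop : Continuous fun u : ℝ => u + b)).intervalIntegrable _ _

/-! ### Monotone cosine transforms -/

/-- `φ` is integrable on the half line and its cosine transform is nonincreasing there. -/
structure HasAntitoneCosTransform (φ : ℝ → ℝ) : Prop where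
  integrableOn : IntegrableOn φ (Ioi 0)
  antitoneOn : AntitoneOn (cosTransform φ) (Ici 0)

namespace HasAntitoneCosTransform

variable {φ : ℝ → ℝ}

lemma le_of_abs_le (h : HasAntitoneCosTransform φ) {x y : ℝ} (hxy : |x| ≤ |y|) :
    cosTransform φ y ≤ cosTransform φ x := by
  rw [← cosTransform_abs φ x, ← cosTransform_abs φ y]
  exact h.antitoneOn (abs_nonneg x) (abs_nonneg y) hxy

lemma mul_sinc (h : HasAntitoneCosTransform φ) {b : ℝ} (hb : 0 ≤ b) :
    HasAntitoneCosTransform (fun t => φ t * sinc (b * t)) := by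
  rcases hb.eq_or_lt with rfl | hb
  · simpa using h
  refine ⟨h.integrableOn.mul_sinc b, fun x hx y hy hxy => ?_⟩
  have hsub := cosTransform_mul_sinc_sub h.integrableOn hb x y
  have hnn : 0 ≤ ∫ u in x..y, (cosTransform φ (u - b) - cosTransform φ (u + b)) := by
    refine intervalIntegral.integral_nonneg hxy fun u hu => sub_nonneg.2 (h.le_of_abs_le ?_)
    have hu0 : 0 ≤ u := le_trans hx hu.1
    rw [abs_of_nonneg (add_nonneg hu0 hb.le), abs_le]
    constructor <;> linarith
  rw [← hsub] at hnn
  exact sub_nonneg.1 (nonneg_of_mul_nonneg_right hnn (by positivity))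

lemma mul_prod_sinc (h : HasAntitoneCosTransform φ) {ι : Type*} (S : Finset ι) {v : ι → ℝ}
    (hv : ∀ i, 0 ≤ v i) : HasAntitoneCosTransform (fun t => φ t * ∏ i ∈ S, sinc (v i * t)) := by
  classical
  induction S using Finset.induction_on with
  | empty => simpa using h
  | insert j S hj ih =>
    convert ih.mul_sinc (hv j) using 2 with t
    rw [Finset.prod_insert hj]
    ring

lemma integral_mul_sinc_anti (h : HasAntitoneCosTransform φ) {b c : ℝ} (hb : 0 ≤ b) (hbc : b ≤ c) :
    ∫ t in Ioi (0 : ℝ), φ t * sinc (c * t) ≤ ∫ t in Ioi (0 : ℝ), φ t * sinc (b * t) := by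
  have hc := continuous_cosTransform h.integrableOn
  have hi (a : ℝ) : IntervalIntegrable (fun u => cosTransform φ (a * u)) volume (-1) 1 :=
    (hc.comp (by fun_prop : Continuous fun u : ℝ => a * u)).intervalIntegrable _ _
  have := intervalIntegral.integral_mono_on (by norm_num) (hi c) (hi b) fun u _ =>
    h.le_of_abs_le (x := b * u) (y := c * u) (by
      rw [abs_mul, abs_mul, abs_of_nonneg hb, abs_of_nonneg (hb.trans hbc)]
      exact mul_le_mul_of_nonneg_right hbc (abs_nonneg u))
  rw [← cosTransform_mul_sinc_zero h.integrableOn, ← cosTransform_mul_sinc_zero h.integrableOn]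
    at this
  linarith

lemma integral_mul_sinc_lt (h : HasAntitoneCosTransform φ)
    (hlt : cosTransform φ 1 < cosTransform φ 0) {b : ℝ} (hb : 0 ≤ b) (hb1 : b < 1) :
    ∫ t in Ioi (0 : ℝ), φ t * sinc t < ∫ t in Ioi (0 : ℝ), φ t * sinc (b * t) := by
  have hc := continuous_cosTransform h.integrableOn
  have hex : ∃ u ∈ Icc (-1 : ℝ) 1, cosTransform φ (1 * u) < cosTransform φ (b * u) := by
    by_contra! hcon
    -- Equality at each `u = b ^ n` would carry the value at `1` down to `0`, by continuity.
    have hpow (n : ℕ) : cosTransform φ (b ^ n) ≤ cosTransform φ 1 := by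
      induction n with
      | zero => simp
      | succ n ih =>
        have hmem : b ^ n ∈ Icc (-1 : ℝ) 1 :=
          ⟨by linarith [pow_nonneg hb n], pow_le_one₀ hb hb1.le⟩
        have := hcon _ hmem
        rw [one_mul, ← pow_succ'] at this
        exact this.trans ih
    have hlim : Tendsto (fun n => cosTransform φ (b ^ n)) atTop (𝓝 (cosTransform φ 0)) :=
      (hc.tendsto 0).comp (tendsto_pow_atTop_nhds_zero_of_lt_one hb hb1)
    exact hlt.not_ge (le_of_tendsto' hlim hpow)
  have := intervalIntegral.integral_lt_integral_of_continuousOn_of_le_of_exists_lt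
    (by norm_num)
    (hc.comp (by fun_prop : Continuous fun u : ℝ => 1 * u)).continuousOn
    (hc.comp (by fun_prop : Continuous fun u : ℝ => b * u)).continuousOn
    (fun u _ => h.le_of_abs_le (x := b * u) (y := 1 * u) (by
      rw [abs_mul, abs_mul, abs_of_nonneg hb, abs_one]
      exact mul_le_mul_of_nonneg_right hb1.le (abs_nonneg u))) hex
  simp only [Function.comp_def] at this
  rw [← cosTransform_mul_sinc_zero h.integrableOn, ← cosTransform_mul_sinc_zero h.integrableOn]
    at this
  simp only [one_mul] at this
  linarith

/-- The integrand of `cosTransform_mul_sinc_sub` is nonnegative on `[0, 1]` and positive at `u = 1`.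
-/
lemma cosTransform_mul_sinc_one_lt (h : HasAntitoneCosTransform φ)
    (hlt : cosTransform φ 1 < cosTransform φ 0) :
    cosTransform (fun t => φ t * sinc (1 * t)) 1 < cosTransform (fun t => φ t * sinc (1 * t)) 0 := by
  have hc := continuous_cosTransform h.integrableOn
  have hsub := cosTransform_mul_sinc_sub h.integrableOn one_pos 0 1
  have hpos : 0 < ∫ u in (0 : ℝ)..1, (cosTransform φ (u - 1) - cosTransform φ (u + 1)) := by
    refine intervalIntegral.integral_pos one_pos ?_ (fun u hu => sub_nonneg.2 (h.le_of_abs_le ?_))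
      ⟨1, by simp, ?_⟩
    · exact ((hc.comp (by fun_prop : Continuous fun u : ℝ => u - 1)).sub
        (hc.comp (by fun_prop : Continuous fun u : ℝ => u + 1))).continuousOn
    · rw [abs_of_nonneg (by linarith [hu.1] : 0 ≤ u + 1), abs_le]
      constructor <;> linarith [hu.1]
    · have h2 : cosTransform φ (1 + 1) ≤ cosTransform φ 1 := h.le_of_abs_le (by norm_num)
      rw [sub_self]
      linarith
  linarith

end HasAntitoneCosTransform

/-! ### Products of two sincs and the Dirichlet constant -/

lemma mul_sinc_eq_sin (x : ℝ) : x * sinc x = sin x := by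
  by_cases hx : x = 0
  · simp [hx]
  · rw [sinc_of_ne_zero hx, mul_div_cancel₀ _ hx]

lemma sinc_sq_le (x : ℝ) : sinc x ^ 2 ≤ 2 * (1 + x ^ 2)⁻¹ := by
  have h1 : sinc x ^ 2 ≤ 1 := (sq_le_one_iff_abs_le_one _).2 (abs_sinc_le_one x)
  have h2 : (x * sinc x) ^ 2 ≤ 1 := by
    rw [mul_sinc_eq_sin]
    exact sin_sq_le_one x
  rw [← div_eq_mul_inv, le_div_iff₀ (by positivity)]
  nlinarith

lemma integrable_sinc_sq : Integrable (fun t => sinc t ^ 2) := by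
  refine Integrable.mono' (integrable_inv_one_add_sq.const_mul 2)
    (by fun_prop : Continuous fun t => sinc t ^ 2).aestronglyMeasurable
    (Eventually.of_forall fun t => ?_)
  rw [norm_of_nonneg (sq_nonneg _)]
  exact sinc_sq_le t

/-- The common value of the integrals of `sinc` and of `sinc ^ 2` over the half line. -/
noncomputable def dirichletConst : ℝ := ∫ t in Ioi (0 : ℝ), sinc t ^ 2

lemma dirichletConst_pos : 0 < dirichletConst := by
  rw [dirichletConst, setIntegral_pos_iff_support_of_nonneg_ae
    (Eventually.of_forall fun t => sq_nonneg _) integrable_sinc_sq.integrableOn]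
  refine lt_of_lt_of_le ?_ (measure_mono (s := Ioo 0 π) fun t ht => ⟨?_, ht.1⟩)
  · simp [pi_pos]
  · rw [Function.mem_support, sinc_of_ne_zero ht.1.ne']
    exact (pow_pos (div_pos (sin_pos_of_pos_of_lt_pi ht.1 ht.2) ht.1) 2).ne'

lemma one_sub_cos_mul_div_sq (c : ℝ) {t : ℝ} (ht : t ≠ 0) :
    (1 - cos (c * t)) / t ^ 2 = c ^ 2 / 2 * sinc (|c| / 2 * t) ^ 2 := by
  have h := mul_sinc_eq_sin (|c| / 2 * t)
  have hcos : cos (c * t) = 1 - 2 * sin (|c| / 2 * t) ^ 2 := by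
    have h2 : cos (c * t) = cos (2 * (|c| / 2 * t)) := by
      rcases abs_choice c with h | h <;> rw [h]
      · ring_nf
      · rw [← cos_neg]; ring_nf
    rw [h2, cos_two_mul, cos_sq']
    ring
  rw [div_eq_iff (pow_ne_zero 2 ht), hcos, ← h, ← sq_abs c]
  ring

lemma integrable_sinc_mul_sq {c : ℝ} (hc : c ≠ 0) : Integrable (fun t => sinc (c * t) ^ 2) :=
  (integrable_comp_mul_left_iff (fun t => sinc t ^ 2) hc).2 integrable_sinc_sq

lemma integrableOn_one_sub_cos (c : ℝ) :
    IntegrableOn (fun t => (1 - cos (c * t)) / t ^ 2) (Ioi 0) := by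
  by_cases hc : c = 0
  · simp [hc]
  · refine IntegrableOn.congr_fun ?_
      (fun t ht => (one_sub_cos_mul_div_sq c (ne_of_gt ht)).symm) measurableSet_Ioi
    exact (integrable_sinc_mul_sq (by positivity)).integrableOn.const_mul _

lemma integral_one_sub_cos (c : ℝ) :
    ∫ t in Ioi (0 : ℝ), (1 - cos (c * t)) / t ^ 2 = |c| * dirichletConst := by
  rw [setIntegral_congr_fun measurableSet_Ioi
    (fun t ht => one_sub_cos_mul_div_sq c (ne_of_gt ht)), integral_const_mul]
  by_cases hc : c = 0
  · simp [hc]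
  have hc' : 0 < |c| / 2 := by positivity
  rw [integral_comp_mul_left_Ioi (fun t => sinc t ^ 2) 0 hc', mul_zero, smul_eq_mul,
    ← dirichletConst, ← sq_abs]
  field_simp

/-- Product-to-sum, with constants inserted so that each term is separately integrable. -/
lemma sinc_mul_sinc_mul_cos {a b t : ℝ} (ha : a ≠ 0) (hb : b ≠ 0) (ht : t ≠ 0) (x : ℝ) :
    cos (x * t) * (sinc (a * t) * sinc (b * t)) = (4 * a * b)⁻¹ *
      ((1 - cos ((a + b + x) * t)) / t ^ 2 + (1 - cos ((a + b - x) * t)) / t ^ 2 -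
        (1 - cos ((a - b + x) * t)) / t ^ 2 - (1 - cos ((a - b - x) * t)) / t ^ 2) := by
  rw [sinc_of_ne_zero (mul_ne_zero ha ht), sinc_of_ne_zero (mul_ne_zero hb ht)]
  simp only [add_mul, sub_mul, cos_add, cos_sub, sin_add, sin_sub]
  field_simp
  ring

lemma integrableOn_sinc_mul_sinc {a b : ℝ} (ha : a ≠ 0) (hb : b ≠ 0) :
    IntegrableOn (fun t => sinc (a * t) * sinc (b * t)) (Ioi 0) := by
  refine Integrable.mono' ((integrable_sinc_mul_sq ha).add (integrable_sinc_mul_sq hb)).integrableOn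
    (by fun_prop : Continuous fun t => sinc (a * t) * sinc (b * t)).aestronglyMeasurable
    (Eventually.of_forall fun t => ?_)
  rw [norm_eq_abs, abs_le, Pi.add_apply]
  constructor <;> nlinarith [sq_nonneg (sinc (a * t) + sinc (b * t)),
    sq_nonneg (sinc (a * t) - sinc (b * t)), sq_nonneg (sinc (a * t)), sq_nonneg (sinc (b * t))]

lemma cosTransform_sinc_mul_sinc {a b : ℝ} (ha : a ≠ 0) (hb : b ≠ 0) (x : ℝ) :
    cosTransform (fun t => sinc (a * t) * sinc (b * t)) x = (4 * a * b)⁻¹ *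
      ((|a + b + x| + |a + b - x| - |a - b + x| - |a - b - x|) * dirichletConst) := by
  have h := integrableOn_one_sub_cos
  rw [cosTransform, setIntegral_congr_fun measurableSet_Ioi
    (fun t ht => sinc_mul_sinc_mul_cos ha hb (ne_of_gt ht) x), integral_const_mul]
  refine congrArg _ ((integral_sub (((h _).add (h _)).sub (h _)) (h _)).trans ?_)
  rw [integral_sub' ((h _).add (h _)) (h _), integral_add' (h _) (h _)]
  simp only [integral_one_sub_cos]
  ring

lemma hasAntitoneCosTransform_sinc_mul_sinc {a b : ℝ} (ha : 0 < a) (hb : 0 < b) :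
    HasAntitoneCosTransform (fun t => sinc (a * t) * sinc (b * t)) := by
  refine ⟨integrableOn_sinc_mul_sinc ha.ne' hb.ne', fun x hx y hy hxy => ?_⟩
  rw [cosTransform_sinc_mul_sinc ha.ne' hb.ne', cosTransform_sinc_mul_sinc ha.ne' hb.ne']
  refine mul_le_mul_of_nonneg_left (mul_le_mul_of_nonneg_right ?_ dirichletConst_pos.le)
    (by positivity)
  have hx : 0 ≤ x := hx
  have hmax (s z : ℝ) (hz : 0 ≤ z) : |s + z| + |s - z| = 2 * max |s| z := by
    rcases abs_cases (s + z) with h1 | h1 <;> rcases abs_cases (s - z) with h2 | h2 <;>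
      rcases abs_cases s with h3 | h3 <;> rcases max_cases |s| z with h4 | h4 <;> linarith
  have e1 := hmax (a + b) x hx
  have e2 := hmax (a + b) y (hx.trans hxy)
  have e3 := hmax (a - b) x hx
  have e4 := hmax (a - b) y (hx.trans hxy)
  have hab : |a - b| ≤ |a + b| := by
    rw [abs_of_pos (add_pos ha hb), abs_le]
    constructor <;> linarith
  -- The transform is a trapezoid: `max s ·` grows less from `x` to `y` when `s` is larger.
  have : max |a + b| y + max |a - b| x ≤ max |a + b| x + max |a - b| y := by
    rcases max_cases |a + b| y with h1 | h1 <;> rcases max_cases |a - b| x with h2 | h2 <;>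
      rcases max_cases |a + b| x with h3 | h3 <;> rcases max_cases |a - b| y with h4 | h4 <;>
      linarith
  linarith

lemma integral_sinc_mul_sinc {b : ℝ} (hb : 0 < b) (hb1 : b ≤ 1) :
    ∫ t in Ioi (0 : ℝ), sinc (1 * t) * sinc (b * t) = dirichletConst := by
  rw [← cosTransform_zero, cosTransform_sinc_mul_sinc one_ne_zero hb.ne', add_zero, sub_zero,
    add_zero, sub_zero, abs_of_pos (by positivity : 0 < 1 + b), abs_of_nonneg (sub_nonneg.2 hb1)]
  field_simp
  ring

lemma hasAntitoneCosTransform_sinc_pow (m : ℕ) :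
    HasAntitoneCosTransform (fun t => sinc t ^ (m + 2)) ∧
      cosTransform (fun t => sinc t ^ (m + 2)) 1 < cosTransform (fun t => sinc t ^ (m + 2)) 0 := by
  induction m with
  | zero =>
    have e : (fun t => sinc t ^ (0 + 2)) = fun t => sinc (1 * t) * sinc (1 * t) := by
      funext t
      ring_nf
    rw [e]
    refine ⟨hasAntitoneCosTransform_sinc_mul_sinc one_pos one_pos, ?_⟩
    rw [cosTransform_sinc_mul_sinc one_ne_zero one_ne_zero,
      cosTransform_sinc_mul_sinc one_ne_zero one_ne_zero]
    have := dirichletConst_pos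
    norm_num [abs_of_pos]
    linarith
  | succ m ih =>
    have e : (fun t => sinc t ^ (m + 1 + 2)) = fun t => sinc t ^ (m + 2) * sinc (1 * t) := by
      funext t
      ring_nf
    rw [e]
    exact ⟨ih.1.mul_sinc zero_le_one, ih.1.cosTransform_mul_sinc_one_lt ih.2⟩

/-! ### Conditional convergence of the sinc integral -/

lemma HasImproperIntegral.of_integrableOn {f : ℝ → ℝ} (hf : IntegrableOn f (Ioi 0)) :
    HasImproperIntegral f (∫ t in Ioi (0 : ℝ), f t) :=
  intervalIntegral_tendsto_integral_Ioi 0 hf tendsto_id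

lemma hasImproperIntegral_sinc : HasImproperIntegral sinc dirichletConst := by
  -- Integration by parts with the primitive `1 - cos t = 2 * sin (t / 2) ^ 2` of `sin t`.
  have hparts (T : ℝ) (hT : 0 ≤ T) : ∫ t in (0 : ℝ)..T, sinc t =
      (∫ t in (0 : ℝ)..T, 2⁻¹ * sinc (2⁻¹ * t) ^ 2) + T / 2 * sinc (T / 2) ^ 2 := by
    have hi : IntervalIntegrable (fun t => 2⁻¹ * sinc (2⁻¹ * t) ^ 2) volume 0 T :=
      (by fun_prop : Continuous fun t => 2⁻¹ * sinc (2⁻¹ * t) ^ 2).intervalIntegrable _ _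
    have h := intervalIntegral.integral_eq_sub_of_hasDerivAt_of_le hT
      (f := fun t => t / 2 * sinc (t / 2) ^ 2)
      (f' := fun t => sinc t - 2⁻¹ * sinc (2⁻¹ * t) ^ 2)
      (by fun_prop) (fun t ht => ?_) ((continuous_sinc.intervalIntegrable _ _).sub hi)
    · rw [intervalIntegral.integral_sub (continuous_sinc.intervalIntegrable _ _) hi] at h
      simp only [zero_div, zero_mul, sub_zero] at h
      linarith
    · have ht0 : t ≠ 0 := ht.1.ne'
      have heq : (fun t => 2 * sin (t / 2) ^ 2 / t) =ᶠ[𝓝 t] fun t => t / 2 * sinc (t / 2) ^ 2 := by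
        filter_upwards [isOpen_ne.mem_nhds ht0] with u hu
        have hu : u ≠ 0 := hu
        rw [sinc_of_ne_zero (by positivity)]
        field_simp
      refine HasDerivAt.congr_of_eventuallyEq ?_ heq.symm
      have hd := (((((hasDerivAt_id t).div_const 2).sin).pow 2).const_mul 2).div
        (hasDerivAt_id t) ht0
      refine hd.congr_deriv ?_
      rw [sinc_of_ne_zero ht0, sinc_of_ne_zero (by positivity), inv_mul_eq_div]
      have : sin t = 2 * sin (t / 2) * cos (t / 2) := by
        rw [← sin_two_mul]; ring_nf
      rw [this]
      simp
      field_simp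
  have hint : IntegrableOn (fun t => 2⁻¹ * sinc (2⁻¹ * t) ^ 2) (Ioi 0) :=
    (integrable_sinc_mul_sq (by norm_num)).integrableOn.const_mul _
  have hval : ∫ t in Ioi (0 : ℝ), 2⁻¹ * sinc (2⁻¹ * t) ^ 2 = dirichletConst := by
    rw [integral_const_mul, integral_comp_mul_left_Ioi (fun t => sinc t ^ 2) 0 (by norm_num),
      mul_zero, smul_eq_mul, ← dirichletConst]
    ring
  have hbdry : Tendsto (fun T : ℝ => T / 2 * sinc (T / 2) ^ 2) atTop (𝓝 0) := by
    refine squeeze_zero_norm' (a := fun T : ℝ => 2 * T⁻¹) ?_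
      (by simpa using tendsto_inv_atTop_zero.const_mul (2 : ℝ))
    filter_upwards [eventually_gt_atTop 0] with T hT
    have h2 : T / 2 * sinc (T / 2) ^ 2 = 2 * T⁻¹ * sin (T / 2) ^ 2 := by
      rw [← mul_sinc_eq_sin]
      field_simp
    rw [norm_of_nonneg (by positivity), h2]
    exact mul_le_of_le_one_right (by positivity) (sin_sq_le_one _)
  have h := (HasImproperIntegral.of_integrableOn hint).add hbdry
  rw [hval, add_zero] at h
  refine h.congr' ?_
  filter_upwards [eventually_ge_atTop 0] with T hT
  exact (hparts T hT).symm

lemma hasImproperIntegral_sinc_mul_sinc {b : ℝ} (hb : 0 ≤ b) (hb1 : b ≤ 1) :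
    HasImproperIntegral (fun t => sinc (1 * t) * sinc (b * t)) dirichletConst := by
  rcases hb.eq_or_lt with rfl | hb
  · simpa using hasImproperIntegral_sinc
  · rw [← integral_sinc_mul_sinc hb hb1]
    exact .of_integrableOn (integrableOn_sinc_mul_sinc one_ne_zero hb.ne')

/-! ### Comparison of sinc integrals -/

/-- The improper integral of `t ↦ ∏ i, sinc (v i * t)` over the half line. -/
noncomputable def sincIntegral {ι : Type*} [Fintype ι] (v : ι → ℝ) : ℝ :=
  limUnder atTop fun T : ℝ => ∫ t in (0 : ℝ)..T, ∏ i, sinc (v i * t)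

section sincIntegral

variable {ι : Type*} [Fintype ι] {v : ι → ℝ}

lemma HasImproperIntegral.sincIntegral_eq {I : ℝ}
    (h : HasImproperIntegral (fun t => ∏ i, sinc (v i * t)) I) : sincIntegral v = I :=
  h.limUnder_eq

lemma hasAntitoneCosTransform_prod_sinc {ι : Type*} {v : ι → ℝ} (hv : ∀ i, 0 ≤ v i) {S : Finset ι} {i j : ι}
    (hi : i ∈ S) (hj : j ∈ S) (hij : i ≠ j) (hvi : 0 < v i) (hvj : 0 < v j) :
    HasAntitoneCosTransform (fun t => ∏ k ∈ S, sinc (v k * t)) := by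
  classical
  convert (hasAntitoneCosTransform_sinc_mul_sinc hvi hvj).mul_prod_sinc ((S.erase i).erase j) hv
    using 2 with t
  rw [mul_assoc, Finset.mul_prod_erase _ (fun k => sinc (v k * t))
    (Finset.mem_erase.2 ⟨hij.symm, hj⟩), Finset.mul_prod_erase _ (fun k => sinc (v k * t)) hi]

lemma prod_sinc_eq [DecidableEq ι] (v : ι → ℝ) (j : ι) (t : ℝ) :
    ∏ i, sinc (v i * t) = (∏ i ∈ Finset.univ.erase j, sinc (v i * t)) * sinc (v j * t) :=
  (Finset.prod_erase_mul _ _ (Finset.mem_univ j)).symm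

lemma prod_sinc_update [DecidableEq ι] (v : ι → ℝ) (j : ι) (c t : ℝ) :
    ∏ i, sinc (Function.update v j c i * t) =
      (∏ i ∈ Finset.univ.erase j, sinc (v i * t)) * sinc (c * t) := by
  rw [prod_sinc_eq _ j, Function.update_self]
  congr 1
  refine Finset.prod_congr rfl fun i hi => ?_
  rw [Function.update_of_ne (Finset.ne_of_mem_erase hi)]

lemma sincIntegral_update [DecidableEq ι] {j : ι} {φ : ℝ → ℝ} {c : ℝ}
    (hprod : ∀ t, ∏ i ∈ Finset.univ.erase j, sinc (v i * t) = φ t) (hφ : IntegrableOn φ (Ioi 0)) :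
    sincIntegral (Function.update v j c) = ∫ t in Ioi (0 : ℝ), φ t * sinc (c * t) := by
  refine HasImproperIntegral.sincIntegral_eq ?_
  simpa only [prod_sinc_update, hprod] using .of_integrableOn (hφ.mul_sinc c)

lemma hasImproperIntegral_sincIntegral (hv : ∀ i, 0 ≤ v i) {i : ι} (hi : v i = 1) :
    HasImproperIntegral (fun t => ∏ i, sinc (v i * t)) (sincIntegral v) := by
  classical
  suffices ∃ I, HasImproperIntegral (fun t => ∏ i, sinc (v i * t)) I by
    obtain ⟨I, hI⟩ := this
    rwa [hI.sincIntegral_eq]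
  by_cases h : ∃ j, j ≠ i ∧ 0 < v j
  · obtain ⟨j, hji, hj⟩ := h
    exact ⟨_, .of_integrableOn (hasAntitoneCosTransform_prod_sinc hv (Finset.mem_univ i)
      (Finset.mem_univ j) hji.symm (by rw [hi]; exact one_pos) hj).integrableOn⟩
  · push Not at h
    refine ⟨dirichletConst, ?_⟩
    convert hasImproperIntegral_sinc using 2 with t
    rw [Finset.prod_eq_single i _ (by simp), hi, one_mul]
    intro j _ hji
    rw [le_antisymm (h j hji) (hv j), zero_mul, sinc_zero]

lemma sincIntegral_update_one_le [DecidableEq ι] (hv : ∀ i, 0 ≤ v i) {i j : ι} (hi : v i = 1)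
    (hji : j ≠ i) (hj : v j ≤ 1) : sincIntegral (Function.update v j 1) ≤ sincIntegral v := by
  by_cases h : ∃ k, k ≠ i ∧ k ≠ j ∧ 0 < v k
  · obtain ⟨k, hki, hkj, hk⟩ := h
    have hφ := hasAntitoneCosTransform_prod_sinc hv (S := Finset.univ.erase j)
      (by simp [hji.symm]) (by simp [hkj]) hki.symm (by rw [hi]; exact one_pos) hk
    have h (c : ℝ) := sincIntegral_update (c := c) (fun _ => rfl) hφ.integrableOn
    rw [h, ← Function.update_eq_self j v, h, Function.update_eq_self]
    exact hφ.integral_mul_sinc_anti (hv j) hj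
  -- Only scales `1` and `v j` remain: both integrals equal `dirichletConst`.
  · push Not at h
    have hprod (t : ℝ) : ∏ k ∈ Finset.univ.erase j, sinc (v k * t) = sinc (1 * t) := by
      rw [Finset.prod_eq_single i _ (by simp [hji.symm]), hi]
      intro k hk hki
      rw [le_antisymm (h k hki (Finset.ne_of_mem_erase hk)) (hv k), zero_mul, sinc_zero]
    have h1 : HasImproperIntegral (fun t => ∏ i, sinc (Function.update v j 1 i * t))
        dirichletConst := by
      simpa only [prod_sinc_update, hprod] using
        hasImproperIntegral_sinc_mul_sinc zero_le_one le_rfl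
    have h2 : HasImproperIntegral (fun t => ∏ i, sinc (v i * t))
        dirichletConst := by
      simpa only [prod_sinc_eq v j, hprod] using hasImproperIntegral_sinc_mul_sinc (hv j) hj
    rw [h1.sincIntegral_eq, h2.sincIntegral_eq]

lemma sincIntegral_piecewise_one_le [DecidableEq ι] (hv : ∀ i, 0 ≤ v i) (hv1 : ∀ i, v i ≤ 1)
    {i : ι} (hi : v i = 1) (S : Finset ι) : sincIntegral (S.piecewise 1 v) ≤ sincIntegral v := by
  induction S using Finset.induction_on with
  | empty => simp
  | insert j S _ ih =>
    refine le_trans ?_ ih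
    have hw : S.piecewise (1 : ι → ℝ) v i = 1 := by
      by_cases h : i ∈ S <;> simp [h, hi]
    rw [Finset.piecewise_insert, Pi.one_apply]
    by_cases hji : j = i
    · rw [hji, ← hw, Function.update_eq_self]
    · refine sincIntegral_update_one_le (fun k => ?_) hw hji ?_
      · by_cases h : k ∈ S <;> simp [h, hv]
      · by_cases h : j ∈ S <;> simp [h, hv1]

lemma sincIntegral_one_le (hv : ∀ i, 0 ≤ v i) (hv1 : ∀ i, v i ≤ 1) {i : ι} (hi : v i = 1) :
    sincIntegral (1 : ι → ℝ) ≤ sincIntegral v := by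
  classical
  simpa using sincIntegral_piecewise_one_le hv hv1 hi Finset.univ

/-- Raise every entry but `j` first; the remaining factor is a power of sinc with exponent at least
`2`, whose transform drops strictly from `0` to `1`. -/
lemma sincIntegral_one_lt (hcard : 3 ≤ Fintype.card ι) (hv : ∀ i, 0 ≤ v i) (hv1 : ∀ i, v i ≤ 1)
    {i : ι} (hi : v i = 1) {j : ι} (hj : v j < 1) :
    sincIntegral (1 : ι → ℝ) < sincIntegral v := by
  classical
  refine lt_of_lt_of_le ?_ (sincIntegral_piecewise_one_le hv hv1 hi (Finset.univ.erase j))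
  obtain ⟨m, hm⟩ := Nat.exists_eq_add_of_le' hcard
  obtain ⟨hφ, hlt⟩ := hasAntitoneCosTransform_sinc_pow m
  have hw : (Finset.univ.erase j).piecewise (1 : ι → ℝ) v = Function.update (1 : ι → ℝ) j (v j) := by
    funext k
    by_cases h : k = j
    · subst h; simp
    · simp [h]
  have hprod (t : ℝ) : ∏ k ∈ Finset.univ.erase j, sinc ((1 : ι → ℝ) k * t) = sinc t ^ (m + 2) := by
    simp [Finset.card_erase_of_mem, hm]
  have h (c : ℝ) := sincIntegral_update (c := c) hprod hφ.integrableOn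
  rw [hw, h, ← Function.update_eq_self j (1 : ι → ℝ), h, Pi.one_apply]
  simpa only [one_mul] using hφ.integral_mul_sinc_lt hlt (hv j) hj

end sincIntegral

/-! ### Rescaling and conclusion -/

lemma HasImproperIntegral.comp_mul_left {f : ℝ → ℝ} {I m : ℝ} (h : HasImproperIntegral f I)
    (hm : 0 < m) : HasImproperIntegral (fun t => f (m * t)) (m⁻¹ * I) := by
  refine (Tendsto.const_mul m⁻¹ (h.comp (tendsto_id.const_mul_atTop hm))).congr fun T => ?_
  simp [intervalIntegral.integral_comp_mul_left _ hm.ne']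

lemma sinc_abs_mul (a t : ℝ) : sinc (|a| * t) = sinc (a * t) := by
  rcases abs_choice a with h | h <;> rw [h]
  rw [neg_mul, sinc_neg]

lemma isCubeVertex_of_abs_eq_one {n : ℕ} {v : Fin n → ℝ} (hv : ∀ i, |v i| = 1) :
    IsCubeVertex v := by
  rw [IsCubeVertex, cube, ← pi_univ_Icc, extremePoints_pi]
  intro i _
  rw [extremePoints_Icc (by norm_num)]
  rcases eq_or_eq_neg_of_abs_eq (hv i) with h | h <;> simp [h]

theorem mainTheorem4 (n : ℕ) (s : EuclideanSpace ℝ (Fin n)) (hs : ‖s‖ = 1) :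
    ∃ I J : ℝ,
      HasImproperIntegral (fun t => ∏ i : Fin n, Real.sinc (s i * t)) I ∧
      HasImproperIntegral (fun t => Real.sinc t ^ n) J ∧
      maxNorm s * I ≥ J ∧
      (maxNorm s * I = J → n = 2 ∨ IsCubeVertex (fun i => s i / maxNorm s)) := by
  have hm : 0 < maxNorm s := by
    refine norm_pos_iff.2 fun h => ?_
    rw [WithLp.ofLp_eq_zero] at h
    simp [h] at hs
  have hne : Nonempty (Fin n) := by
    by_contra hemp
    rw [not_nonempty_iff] at hemp
    exact hm.ne' (by simp [maxNorm, Subsingleton.elim (WithLp.ofLp s) 0])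
  have hle (i : Fin n) : |s i| ≤ maxNorm s := norm_le_pi_norm (WithLp.ofLp s) i
  obtain ⟨i, hi⟩ : ∃ i, |s i| = maxNorm s := by
    obtain ⟨i, hi⟩ := Finite.exists_max fun i => |s i|
    exact ⟨i, (hle i).antisymm ((pi_norm_le_iff_of_nonneg (abs_nonneg _)).2 hi)⟩
  set m := maxNorm s
  let v : Fin n → ℝ := fun i => |s i| / m
  have hv (i) : 0 ≤ v i := by positivity
  have hv1 (i) : v i ≤ 1 := (div_le_one hm).2 (hle i)
  have hvi : v i = 1 := (div_eq_one_iff_eq hm.ne').2 hi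
  refine ⟨m⁻¹ * sincIntegral v, sincIntegral (1 : Fin n → ℝ), ?_, ?_, ?_, ?_⟩
  · convert (hasImproperIntegral_sincIntegral hv hvi).comp_mul_left hm using 3 with t i
    rw [← mul_assoc, div_mul_cancel₀ _ hm.ne', sinc_abs_mul]
  · simpa using hasImproperIntegral_sincIntegral (v := (1 : Fin n → ℝ)) (i := i) (by simp) rfl
  · rw [mul_inv_cancel_left₀ hm.ne']
    exact sincIntegral_one_le hv hv1 hvi
  · rw [mul_inv_cancel_left₀ hm.ne']
    intro heq
    by_contra! hcon
    obtain ⟨hn, hvert⟩ := hcon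
    obtain ⟨j, hj⟩ : ∃ j, v j ≠ 1 := by
      by_contra! hall
      exact hvert (isCubeVertex_of_abs_eq_one fun i => by
        rw [abs_div, abs_of_pos hm]; exact hall i)
    have hji : j ≠ i := fun h => hj (h ▸ hvi)
    have hcard : 3 ≤ Fintype.card (Fin n) := by
      have : Nontrivial (Fin n) := ⟨j, i, hji⟩
      have := Fintype.one_lt_card (α := Fin n)
      rw [Fintype.card_fin] at *
      omega
    exact (sincIntegral_one_lt hcard hv hv1 hvi (lt_of_le_of_ne (hv1 j) hj)).ne' heq
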